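/- Let $X$ be a metric space with Borel $\sigma$-algebra $\mathcal B(X)$, and let $\pi : X\times\mathcal B(X)\to[0,1]$ be the transition function of a discrete-time Markov chain, with $n$-step transition functions $\pi^n$: $\pi(x,\cdot)$ is a probability measure for every $x\in X$, and $\pi(\cdot,A)$ is Borel measurable for every $A\in\mathcal B(X)$. Let $C_b(X)$ be the space of bounded continuous functions $X\to\mathbb R$, and suppose that $\pi$ is Feller, i.e. $x\mapsto\int_X\varphi(y)\,\pi(x,dy)$ is continuous for every $\varphi\in C_b(X)$. Assume that there exists $z\in X$ such that: (i) for every $\varepsilon>0$ there exists $\alpha>0$ such that $\liminf_{n\to\infty}\pi^n(x,B(z,\varepsilon))\ge\alpha$ for every $x\in X$, where $B(z,\varepsilon)$ is the open ball; (ii) for every $\varphi\in C_b(X)$ the family of functions $x\mapsto\int_X\varphi(y)\,\pi^n(x,dy)$, $n\in\mathbb N$, is equicontinuous at the point $z$. (The Feller property and (ii) both hold, in particular, if for every $\varphi\in C_b(X)$ the family in (ii) is equicontinuous at every point of $X$.) Then the chain has a unique invariant Borel probability measure $\mu_*$, i.e. a unique Borel probability measure with $\int_X\pi(x,\cdot)\,\mu_*(dx)=\mu_*$,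 and for every Borel probability measure $\mu$ on $X$ the measures $\int_X\pi^n(x,\cdot)\,\mu(dx)$ converge weakly to $\mu_*$ as $n\to\infty$. -/

import Mathlib

open MeasureTheory ProbabilityTheory Filter Topology
open scoped ENNReal BoundedContinuousFunction

/-- A transition function (Markov kernel) `π` is Feller if `x ↦ ∫ φ(y) π(x, dy)` is continuous
for every bounded continuous `φ`. -/
def IsFellerKernel {X : Type*} [TopologicalSpace X] [MeasurableSpace X]
    (π : Kernel X X) : Prop :=
  ∀ φ : X →ᵇ ℝ, Continuous fun x ↦ ∫ y, φ y ∂(π x)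

/-- The `n`-step transition function of a Markov kernel is a Markov kernel. -/
theorem isMarkovKernel_pow {X : Type*} [MeasurableSpace X] (π : Kernel X X) [IsMarkovKernel π]
    (n : ℕ) : IsMarkovKernel (π ^ n) := by
  induction n with
  | zero => rw [pow_zero]; exact inferInstanceAs (IsMarkovKernel (Kernel.id : Kernel X X))
  | succ k ih => rw [pow_succ]; exact inferInstanceAs (IsMarkovKernel ((π ^ k) ∘ₖ π))

/-- The law `∫ πⁿ(x, ·) μ(dx)` after `n` steps of the Markov chain with transition function `π`
and initial law `μ`. -/
noncomputable def stepLaw {X : Type*} [MeasurableSpace X] (π : Kernel X X) [IsMarkovKernel π]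
    (n : ℕ) (μ : ProbabilityMeasure X) : ProbabilityMeasure X :=
  ⟨(μ : Measure X).bind (π ^ n : Kernel X X), by
    haveI := isMarkovKernel_pow π n
    infer_instance⟩

/-! Write `P^n φ(x)` for `stepMean π n φ x`. The proof has two halves: merging of trajectories, and
existence of an invariant law on a metric space that need be neither complete nor separable. Merging
(`asympSep_eq_zero`): let `G` be the supremum over pairs of starting points of `limsup |P^n φ(x) -
P^n φ(y)|`. Run two independent copies until both lie in a small ball around `z` with probability at
least `b²`. There, equicontinuity makes the separation at most `ε`; elsewhere it is at most `G`.
Hence `G ≤ G - b²(G - ε)`, so `G ≤ ε`. Existence: limits of `P^n φ(z)` along an ultrafilter define a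
positive functional `L`. It comes from a measure as soon as it is `σ`-smooth
(`exists_measure_of_isSigmaSmooth`), which takes the place of tightness. If `σ`-smoothness failed, a
gliding hump (`false_of_increments`) would build one bounded continuous function whose expectations
are not equicontinuous at `z`. Merging from the initial laws `δ_z` and `π(z, ·)` makes the measure
invariant; merging again gives convergence, hence uniqueness. -/

/-! ### Daniell representation of `σ`-smooth functionals on a metric space. -/

section Daniell

variable {X : Type*} [MetricSpace X]

/-- The inner content of a set `U` with respect to a functional `L` on bounded continuous
functions: the supremum of `L f` over all `0 ≤ f ≤ 1_U`. -/
noncomputable def innerContent (L : (X →ᵇ ℝ) →ₗ[ℝ] ℝ) (U : Set X) : ℝ≥0∞ :=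
  ⨆ (f : X →ᵇ ℝ) (_ : 0 ≤ f ∧ ∀ x, f x ≤ U.indicator 1 x), ENNReal.ofReal (L f)

/-- A linear functional on bounded continuous functions is `σ`-smooth if it is continuous along
sequences that decrease pointwise to zero. -/
def IsSigmaSmooth (L : (X →ᵇ ℝ) →ₗ[ℝ] ℝ) : Prop :=
  ∀ φ : ℕ → X →ᵇ ℝ, Antitone φ → φ 0 ≤ 1 → (∀ x, Tendsto (fun k ↦ φ k x) atTop (𝓝 0)) →
    Tendsto (fun k ↦ L (φ k)) atTop (𝓝 0)

variable {L : (X →ᵇ ℝ) →ₗ[ℝ] ℝ}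

theorem le_innerContent {U : Set X} {f : X →ᵇ ℝ} (hf : 0 ≤ f)
    (hfU : ∀ x, f x ≤ U.indicator 1 x) : ENNReal.ofReal (L f) ≤ innerContent L U :=
  le_iSup₂_of_le f ⟨hf, hfU⟩ le_rfl

theorem innerContent_empty : innerContent L ∅ = 0 := by
  simp only [innerContent, ENNReal.iSup_eq_zero]
  intro f ⟨hf, hf'⟩
  have : f = 0 := le_antisymm (fun x ↦ by simpa using hf' x) hf
  simp [this]

theorem innerContent_mono {U V : Set X} (h : U ⊆ V) : innerContent L U ≤ innerContent L V :=
  iSup₂_le fun _ ⟨hf, hfU⟩ ↦ le_innerContent hf fun x ↦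
    (hfU x).trans (Set.indicator_le_indicator_of_subset h (fun _ ↦ zero_le_one) x)

theorem functional_mono (hpos : ∀ f, 0 ≤ f → 0 ≤ L f) {f g : X →ᵇ ℝ} (h : f ≤ g) :
    L f ≤ L g := by
  have := hpos (g - f) (sub_nonneg.2 h)
  rw [map_sub] at this
  linarith

theorem innerContent_univ (hpos : ∀ f, 0 ≤ f → 0 ≤ L f) :
    innerContent L Set.univ = ENNReal.ofReal (L 1) := by
  refine le_antisymm (iSup₂_le fun f ⟨_, hfU⟩ ↦ ?_)
    (le_innerContent (fun _ ↦ zero_le_one' ℝ) fun x ↦ by simp)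
  refine ENNReal.ofReal_le_ofReal (functional_mono hpos fun x ↦ ?_)
  simpa using hfU x

/-- The continuous functions `min 1 (k * dist(x, Uᶜ))` approximating `1_U` from below. -/
theorem exists_approx_isOpen {U : Set X} (hU : IsOpen U) :
    ∃ g : ℕ → X →ᵇ ℝ, Monotone g ∧ (∀ k, 0 ≤ g k) ∧ (∀ k x, g k x ≤ U.indicator 1 x) ∧
      ∀ x ∈ U, ∃ k, g k x = 1 := by
  let g : ℕ → X →ᵇ ℝ := fun k ↦ BoundedContinuousFunction.mkOfBound
    ⟨fun x ↦ min 1 (k * Metric.infDist x Uᶜ), by fun_prop⟩ 1 (fun x y ↦ by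
      have h1 : 0 ≤ min 1 (k * Metric.infDist x Uᶜ) :=
        le_min zero_le_one (mul_nonneg k.cast_nonneg Metric.infDist_nonneg)
      have h2 : 0 ≤ min 1 (k * Metric.infDist y Uᶜ) :=
        le_min zero_le_one (mul_nonneg k.cast_nonneg Metric.infDist_nonneg)
      have h3 := min_le_left 1 (k * Metric.infDist x Uᶜ)
      have h4 := min_le_left 1 (k * Metric.infDist y Uᶜ)
      simp only [ContinuousMap.coe_mk, Real.dist_eq, abs_le]
      constructor <;> linarith)
  -- `Metric.infDist` to the empty set is `0`, so `g` would vanish for `U = univ`; that case takes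
  -- the constant `1`.
  by_cases hne : Uᶜ.Nonempty
  · refine ⟨g, fun k l hkl x ↦ ?_, fun k x ↦ ?_, fun k x ↦ ?_, fun x hx ↦ ?_⟩
    · exact min_le_min_left _
        (mul_le_mul_of_nonneg_right (Nat.cast_le.2 hkl) Metric.infDist_nonneg)
    · exact le_min zero_le_one (mul_nonneg k.cast_nonneg Metric.infDist_nonneg)
    · have : g k x = min 1 (k * Metric.infDist x Uᶜ) := rfl
      by_cases hx : x ∈ U
      · rw [this, Set.indicator_of_mem hx]
        exact min_le_left _ _
      · simp [this, hx, Metric.infDist_zero_of_mem (show x ∈ Uᶜ from hx)]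
    · have hpos : 0 < Metric.infDist x Uᶜ :=
        (hU.isClosed_compl.notMem_iff_infDist_pos hne).1 (by simpa using hx)
      obtain ⟨k, hk⟩ := exists_nat_ge (1 / Metric.infDist x Uᶜ)
      exact ⟨k, min_eq_left (by rwa [div_le_iff₀ hpos] at hk)⟩
  · rw [Set.not_nonempty_iff_eq_empty, Set.compl_empty_iff] at hne
    subst hne
    exact ⟨fun _ ↦ 1, monotone_const, fun _ _ ↦ zero_le_one' ℝ, by simp, fun x _ ↦ ⟨0, rfl⟩⟩

/-- This is where `σ`-smoothness enters. If `f` lies below the indicator of the union, the part of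
`f` above the sum of the first `k` approximants decreases pointwise to zero, so its `L`-value
vanishes in the limit. -/
theorem innerContent_iUnion_le (hpos : ∀ f, 0 ≤ f → 0 ≤ L f) (hσ : IsSigmaSmooth L)
    (U : ℕ → Set X) (hU : ∀ i, IsOpen (U i)) :
    innerContent L (⋃ i, U i) ≤ ∑' i, innerContent L (U i) := by
  refine iSup₂_le fun f ⟨hf, hfU⟩ ↦ ?_
  choose g gmono gnonneg gle gone using fun i ↦ exists_approx_isOpen (hU i)
  let h : ℕ → X →ᵇ ℝ := fun k ↦ ∑ i ∈ Finset.range k, g i k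
  have hmono : Monotone h := fun k l hkl ↦ by
    calc h k ≤ ∑ i ∈ Finset.range k, g i l := Finset.sum_le_sum fun i _ ↦ gmono i hkl
      _ ≤ h l := Finset.sum_le_sum_of_subset_of_nonneg (by simpa using hkl)
        fun i _ _ ↦ gnonneg i l
  have hh : ∀ k x, h k x = ∑ i ∈ Finset.range k, g i k x := fun k x ↦ by
    simp [h]
  have hf1 : f ≤ 1 := fun x ↦ (hfU x).trans (Set.indicator_le_self' (by simp) x)
  have hlim : Tendsto (fun k ↦ L ((f - h k) ⊔ 0)) atTop (𝓝 0) := by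
    refine hσ _ (fun k l hkl ↦ sup_le_sup_right (sub_le_sub_left (hmono hkl) f) 0) ?_ ?_
    · exact sup_le (by simpa [h] using hf1) fun _ ↦ zero_le_one' ℝ
    · intro x
      refine tendsto_const_nhds.congr' ?_
      by_cases hx : x ∈ ⋃ i, U i
      · obtain ⟨i, hi⟩ := Set.mem_iUnion.1 hx
        obtain ⟨k, hk⟩ := gone i x hi
        filter_upwards [eventually_ge_atTop k, eventually_gt_atTop i] with l hl hil
        have h1 : g i k x ≤ g i l x := gmono i hl x
        have h2 : g i l x ≤ h l x := by
          rw [hh]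
          exact Finset.single_le_sum (f := fun i ↦ g i l x) (fun j _ ↦ gnonneg j l x)
            (Finset.mem_range.2 hil)
        have h3 : f x ≤ 1 := hf1 x
        symm
        change max (f x - h l x) 0 = 0
        exact max_eq_right (by linarith)
      · have h3 := hfU x
        simp only [Set.indicator_of_notMem hx] at h3
        refine Eventually.of_forall fun l ↦ ?_
        have h2 : 0 ≤ h l x := by
          rw [hh]
          exact Finset.sum_nonneg (fun j _ ↦ gnonneg j l x)
        symm
        change max (f x - h l x) 0 = 0
        exact max_eq_right (by linarith)
  have hle : ∀ k, ENNReal.ofReal (L f) ≤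
      ∑' i, innerContent L (U i) + ENNReal.ofReal (L ((f - h k) ⊔ 0)) := fun k ↦ by
    have h1 : L f ≤ ∑ i ∈ Finset.range k, L (g i k) + L ((f - h k) ⊔ 0) := by
      rw [← map_sum, ← map_add]
      refine functional_mono hpos ?_
      rw [← sub_le_iff_le_add']
      exact le_sup_left
    refine (ENNReal.ofReal_le_ofReal h1).trans (ENNReal.ofReal_add_le.trans ?_)
    gcongr
    rw [ENNReal.ofReal_sum_of_nonneg fun i _ ↦ hpos _ (gnonneg i k)]
    exact (Finset.sum_le_sum fun i _ ↦ le_innerContent (gnonneg i k) (gle i k)).trans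
      (ENNReal.sum_le_tsum _)
  have hlim' := (ENNReal.tendsto_ofReal hlim).const_add (∑' i, innerContent L (U i))
  rw [ENNReal.ofReal_zero, add_zero] at hlim'
  exact ge_of_tendsto' hlim' hle

theorem innerContent_add_le (hpos : ∀ f, 0 ≤ f → 0 ≤ L f) {U V W : Set X}
    (hUV : Disjoint U V) (hU : U ⊆ W) (hV : V ⊆ W) :
    innerContent L U + innerContent L V ≤ innerContent L W := by
  have key : ∀ f : X →ᵇ ℝ, 0 ≤ f → (∀ x, f x ≤ U.indicator 1 x) → ∀ g : X →ᵇ ℝ, 0 ≤ g →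
      (∀ x, g x ≤ V.indicator 1 x) →
      ENNReal.ofReal (L f) + ENNReal.ofReal (L g) ≤ innerContent L W := by
    intro f hf hfU g hg hgV
    rw [← ENNReal.ofReal_add (hpos f hf) (hpos g hg), ← map_add]
    refine le_innerContent (add_nonneg hf hg) fun x ↦ ?_
    have h1 := hfU x
    have h2 := hgV x
    change f x + g x ≤ _
    by_cases hxU : x ∈ U
    · have hxV : x ∉ V := Set.disjoint_left.1 hUV hxU
      simp only [hxU, hxV, hU hxU, Set.indicator_of_mem, Set.indicator_of_notMem,
        not_false_eq_true, Pi.one_apply] at h1 h2 ⊢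
      linarith
    · simp only [hxU, Set.indicator_of_notMem, not_false_eq_true] at h1
      have := Set.indicator_le_indicator_of_subset (f := (1 : X → ℝ)) hV (fun _ ↦ zero_le_one' ℝ) x
      linarith
  exact ENNReal.biSup_add_biSup_le' ⟨0, le_rfl, fun x ↦ Set.indicator_nonneg (by simp) x⟩
    ⟨0, le_rfl, fun x ↦ Set.indicator_nonneg (by simp) x⟩
    fun f hf g hg ↦ key f hf.1 hf.2 g hg.1 hg.2

/-- The outer measure generated by the inner content of open sets. -/
noncomputable def outerOfFunctional (L : (X →ᵇ ℝ) →ₗ[ℝ] ℝ) : OuterMeasure X :=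
  inducedOuterMeasure (P := IsOpen) (fun U _ ↦ innerContent L U) isOpen_empty innerContent_empty

theorem outerOfFunctional_eq (hpos : ∀ f, 0 ≤ f → 0 ≤ L f) (hσ : IsSigmaSmooth L)
    {U : Set X} (hU : IsOpen U) : outerOfFunctional L U = innerContent L U :=
  inducedOuterMeasure_eq' (fun _ h ↦ isOpen_iUnion h)
    (fun _ h ↦ innerContent_iUnion_le hpos hσ _ h) (fun _ _ _ _ h ↦ innerContent_mono h) hU

/-- Sets at distance at least `r` have disjoint open `r/2`-neighbourhoods, and the inner content is
superadditive on disjoint open sets. By Carathéodory's criterion all Borel sets are then measurable.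
-/
theorem isMetric_outerOfFunctional (hpos : ∀ f, 0 ≤ f → 0 ≤ L f) (hσ : IsSigmaSmooth L) :
    (outerOfFunctional L).IsMetric := by
  rintro A B ⟨r, hr0, hr⟩
  refine le_antisymm (measure_union_le A B) ?_
  conv_rhs => rw [outerOfFunctional, inducedOuterMeasure_eq_iInf (fun _ h ↦ isOpen_iUnion h)
    (fun _ h ↦ innerContent_iUnion_le hpos hσ _ h) (fun _ _ _ _ h ↦ innerContent_mono h)]
  refine le_iInf₂ fun W hW ↦ le_iInf fun hABW ↦ ?_
  let U := W ∩ ⋃ x ∈ A, Metric.eball x (r / 2)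
  let V := W ∩ ⋃ x ∈ B, Metric.eball x (r / 2)
  have hU : IsOpen U := hW.inter (isOpen_biUnion fun _ _ ↦ Metric.isOpen_eball)
  have hV : IsOpen V := hW.inter (isOpen_biUnion fun _ _ ↦ Metric.isOpen_eball)
  have hr2 : 0 < r / 2 := ENNReal.half_pos hr0
  have hAU : A ⊆ U := fun x hx ↦ ⟨hABW (Or.inl hx), Set.mem_biUnion hx (Metric.mem_eball_self hr2)⟩
  have hBV : B ⊆ V := fun x hx ↦ ⟨hABW (Or.inr hx), Set.mem_biUnion hx (Metric.mem_eball_self hr2)⟩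
  have hd : Disjoint U V := by
    rw [Set.disjoint_left]
    rintro y ⟨_, hyA⟩ ⟨_, hyB⟩
    simp only [Set.mem_iUnion, Metric.mem_eball, exists_prop] at hyA hyB
    obtain ⟨a, ha, hya⟩ := hyA
    obtain ⟨b, hb, hyb⟩ := hyB
    refine (hr a ha b hb).not_gt ((edist_triangle_left a b y).trans_lt ?_)
    exact (ENNReal.add_lt_add hya hyb).trans_eq (ENNReal.add_halves r)
  calc outerOfFunctional L A + outerOfFunctional L B
      ≤ outerOfFunctional L U + outerOfFunctional L V := by gcongr
    _ = innerContent L U + innerContent L V := by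
      rw [outerOfFunctional_eq hpos hσ hU, outerOfFunctional_eq hpos hσ hV]
    _ ≤ innerContent L W :=
      innerContent_add_le hpos hd Set.inter_subset_left Set.inter_subset_left

/-- The layer `max 0 (min (f - a) d)` of a bounded continuous function. -/
noncomputable def layer (f : X →ᵇ ℝ) (a d : ℝ) : X →ᵇ ℝ :=
  f ⊓ BoundedContinuousFunction.const X (a + d) - f ⊓ BoundedContinuousFunction.const X a

theorem layer_apply (f : X →ᵇ ℝ) (a d : ℝ) (x : X) :
    layer f a d x = min (f x) (a + d) - min (f x) a := rfl

theorem sum_layer (f : X →ᵇ ℝ) (d : ℝ) (n : ℕ) :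
    ∑ i ∈ Finset.range n, layer f (i * d) d =
      f ⊓ BoundedContinuousFunction.const X (n * d) -
        f ⊓ BoundedContinuousFunction.const X 0 := by
  induction n with
  | zero => simp
  | succ n ih =>
    rw [Finset.sum_range_succ, ih, layer]
    have : (n : ℝ) * d + d = ((n + 1 : ℕ) : ℝ) * d := by push_cast; ring
    rw [this]
    abel

variable [MeasurableSpace X] [BorelSpace X]

/-- Slice `f` into layers of height `d`. With `U = {f > a + d}`, the layer above `a + d` is at most
`d • 1_U`, and the layer below it is at least `d • 1_U`. Comparing each layer with the one beneath
leaves only the bottom layer over, at a cost of at most `d * L 1`. -/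
theorem functional_le_integral (hpos : ∀ f, 0 ≤ f → 0 ≤ L f) {μ : Measure X} [IsFiniteMeasure μ]
    (hμ : ∀ U, IsOpen U → μ U = innerContent L U) {f : X →ᵇ ℝ} (hf0 : 0 ≤ f) (hf1 : f ≤ 1) :
    L f ≤ ∫ x, f x ∂μ := by
  have layer_le : ∀ a d : ℝ, 0 < d → L (layer f (a + d) d) ≤ ∫ x, layer f a d x ∂μ := by
    intro a d hd
    let U := {x | a + d < f x}
    have hU : IsOpen U := isOpen_lt continuous_const f.continuous
    have h1 : L (layer f (a + d) d) ≤ d * μ.real U := by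
      have h2 : ENNReal.ofReal (L (d⁻¹ • layer f (a + d) d)) ≤ μ U := by
        rw [hμ U hU]
        refine le_innerContent (fun x ↦ ?_) (fun x ↦ ?_)
        · change 0 ≤ d⁻¹ * layer f (a + d) d x
          rw [layer_apply]
          exact mul_nonneg (inv_nonneg.2 hd.le)
            (sub_nonneg.2 (min_le_min_left _ (by linarith)))
        · change d⁻¹ * layer f (a + d) d x ≤ _
          rw [layer_apply, inv_mul_le_iff₀ hd]
          by_cases hx : x ∈ U
          · have hx' : a + d < f x := hx
            rw [Set.indicator_of_mem hx, min_eq_right hx'.le, Pi.one_apply]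
            linarith [min_le_right (f x) (a + d + d)]
          · have hx' : f x ≤ a + d := not_lt.1 hx
            rw [Set.indicator_of_notMem hx, min_eq_left hx', min_eq_left (by linarith)]
            simp
      rw [ENNReal.ofReal_le_iff_le_toReal (measure_ne_top _ _), map_smul, smul_eq_mul,
        inv_mul_le_iff₀ hd] at h2
      exact h2
    refine h1.trans ?_
    rw [mul_comm, ← smul_eq_mul, ← integral_indicator_const d hU.measurableSet]
    refine integral_mono ((integrable_const d).indicator hU.measurableSet)
      (BoundedContinuousFunction.integrable μ _) fun x ↦ ?_
    rw [layer_apply]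
    by_cases hx : x ∈ U
    · have hx' : a + d < f x := hx
      rw [Set.indicator_of_mem hx, min_eq_right hx'.le, min_eq_right (by linarith)]
      linarith
    · rw [Set.indicator_of_notMem hx]
      exact sub_nonneg.2 (min_le_min_left _ (by linarith))
  have main : ∀ n : ℕ, L f ≤ ∫ x, f x ∂μ + L 1 * (1 / ((n : ℝ) + 1)) := by
    intro n
    set d : ℝ := 1 / ((n : ℝ) + 1) with hd
    have hd0 : 0 < d := by positivity
    have hnd : ((n + 1 : ℕ) : ℝ) * d = 1 := by rw [hd]; push_cast; field_simp
    have hf0' : f ⊓ BoundedContinuousFunction.const X 0 = 0 := inf_eq_right.2 hf0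
    have hsum : ∑ i ∈ Finset.range (n + 1), layer f (i * d) d = f := by
      rw [sum_layer, hnd, hf0', sub_zero]
      exact inf_eq_left.2 hf1
    have hint : ∑ i ∈ Finset.range n, ∫ x, layer f (i * d) d x ∂μ ≤ ∫ x, f x ∂μ := by
      rw [← integral_finsetSum _ fun i _ ↦ BoundedContinuousFunction.integrable μ _]
      refine integral_mono (integrable_finsetSum _
        fun i _ ↦ BoundedContinuousFunction.integrable μ _)
        (BoundedContinuousFunction.integrable μ _) fun x ↦ ?_
      have := congrArg (fun h : X →ᵇ ℝ ↦ h x) (sum_layer f d n)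
      simp only [hf0', BoundedContinuousFunction.coe_sum, Finset.sum_apply, sub_zero] at this
      simp only [this]
      exact min_le_left _ _
    have h0 : L (layer f ((0 : ℕ) * d) d) ≤ L 1 * d := by
      rw [mul_comm (L 1), ← smul_eq_mul d (L 1), ← map_smul]
      refine functional_mono hpos fun x ↦ ?_
      change layer f ((0 : ℕ) * d) d x ≤ d * 1
      rw [layer_apply]
      have h1 := hf0 x
      have h2 := min_le_right (f x) (d : ℝ)
      simp only [Nat.cast_zero, zero_mul, zero_add, mul_one]
      rw [min_eq_right (show 0 ≤ f x from h1)]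
      linarith
    calc L f = ∑ i ∈ Finset.range (n + 1), L (layer f (i * d) d) := by rw [← map_sum, hsum]
      _ = ∑ i ∈ Finset.range n, L (layer f (i * d + d) d) + L (layer f ((0 : ℕ) * d) d) := by
        rw [Finset.sum_range_succ']
        simp only [Nat.cast_add, Nat.cast_one, add_mul, one_mul]
      _ ≤ _ := add_le_add ((Finset.sum_le_sum fun i _ ↦ layer_le _ _ hd0).trans hint) h0
  have hlim := (tendsto_one_div_add_atTop_nhds_zero_nat (𝕜 := ℝ)).const_mul (L 1)
  have hlim' := hlim.const_add (∫ x, f x ∂μ)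
  rw [mul_zero, add_zero] at hlim'
  exact ge_of_tendsto' hlim' main

/-- **Daniell representation** on a metric space: a positive `σ`-smooth functional on bounded
continuous functions is integration against a finite Borel measure. -/
theorem exists_measure_of_isSigmaSmooth (hpos : ∀ f, 0 ≤ f → 0 ≤ L f) (hσ : IsSigmaSmooth L) :
    ∃ μ : Measure X, IsFiniteMeasure μ ∧ ∀ f : X →ᵇ ℝ, ∫ x, f x ∂μ = L f := by
  let μ : Measure X := (outerOfFunctional L).toMeasure
    (isMetric_outerOfFunctional hpos hσ).le_caratheodory
  have hμ : ∀ U, IsOpen U → μ U = innerContent L U := fun U hU ↦ by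
    rw [toMeasure_apply _ _ hU.measurableSet, outerOfFunctional_eq hpos hσ hU]
  have huniv : μ Set.univ = ENNReal.ofReal (L 1) := by
    rw [hμ _ isOpen_univ, innerContent_univ hpos]
  have hfin : IsFiniteMeasure μ := ⟨by rw [huniv]; exact ENNReal.ofReal_lt_top⟩
  have hL1 : 0 ≤ L 1 := hpos 1 fun _ ↦ zero_le_one' ℝ
  have hreal : μ.real Set.univ = L 1 := by
    rw [Measure.real, huniv, ENNReal.toReal_ofReal hL1]
  have hunit : ∀ f : X →ᵇ ℝ, 0 ≤ f → f ≤ 1 → ∫ x, f x ∂μ = L f := fun f hf0 hf1 ↦ by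
    refine le_antisymm ?_ (functional_le_integral hpos hμ hf0 hf1)
    -- The same inequality for `1 - f`, together with total mass `L 1`, gives the reverse inequality
    -- for `f`.
    have h := functional_le_integral hpos hμ (sub_nonneg.2 hf1) (sub_le_self 1 hf0)
    have h2 : ∫ x, (1 - f) x ∂μ = L 1 - ∫ x, f x ∂μ := by
      simp only [BoundedContinuousFunction.coe_sub, BoundedContinuousFunction.coe_one,
        Pi.sub_apply, Pi.one_apply]
      rw [integral_sub (integrable_const _) (BoundedContinuousFunction.integrable μ _)]
      simp [hreal]
    rw [map_sub, h2] at h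
    linarith
  refine ⟨μ, hfin, fun f ↦ ?_⟩
  set c := ‖f‖ + 1
  have hc : 0 < c := by positivity
  have hfc : ∀ x, |f x| ≤ c := fun x ↦ (f.norm_coe_le_norm x).trans (by simp [c])
  -- Affine rescaling of `f` from `[-c, c]` into `[0, 1]`.
  let g : X →ᵇ ℝ := (2 * c)⁻¹ • (f + c • 1)
  have hg : ∀ x, g x = (2 * c)⁻¹ * (f x + c) := fun x ↦ by simp [g, mul_add]
  have hfg : f = (2 * c) • g - c • 1 := by
    simp only [g]
    rw [smul_inv_smul₀ (by positivity)]
    abel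
  have hgL := hunit g (fun x ↦ by
      change 0 ≤ g x
      rw [hg]; have := (abs_le.1 (hfc x)).1
      exact mul_nonneg (by positivity) (by linarith))
    (fun x ↦ by
      change g x ≤ 1
      rw [hg]; have := (abs_le.1 (hfc x)).2
      rw [inv_mul_le_iff₀ (by positivity)]
      linarith)
  have hint : ∫ x, f x ∂μ = 2 * c * ∫ x, g x ∂μ - c * L 1 := by
    rw [← integral_const_mul, ← hreal]
    have : c * μ.real Set.univ = ∫ _, c ∂μ := by simp [mul_comm]
    rw [this, ← integral_sub ((BoundedContinuousFunction.integrable μ g).const_mul _)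
      (integrable_const _)]
    congr 1 with x
    rw [hg]
    field_simp
    ring
  rw [hint, hgL]
  conv_rhs => rw [hfg]
  simp

end Daniell

/-! ### Expectations after `n` steps. -/

section StepMean

theorem integral_measure_bind {X Y : Type*} [MeasurableSpace X] [MeasurableSpace Y]
    {μ : Measure X} {κ : Kernel X Y} {f : Y → ℝ} (hf : Integrable f (μ.bind κ)) :
    ∫ y, f y ∂(μ.bind κ) = ∫ x, ∫ y, f y ∂(κ x) ∂μ := by
  have h : (κ ∘ₖ Kernel.const Unit μ) () = μ.bind κ := by
    rw [Kernel.comp_apply, Kernel.const_apply]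
  rw [← h] at hf ⊢
  rw [Kernel.integral_comp hf, Kernel.const_apply]

variable {X : Type*} [MetricSpace X] [MeasurableSpace X]

/-- The expectation of `φ` after `n` steps of the chain, as a function of the starting point. -/
noncomputable def stepMean (π : Kernel X X) (n : ℕ) (φ : X →ᵇ ℝ) (x : X) : ℝ :=
  ∫ y, φ y ∂((π ^ n) x)

variable (π : Kernel X X)

theorem stepMean_smul (n : ℕ) (c : ℝ) (φ : X →ᵇ ℝ) (x : X) :
    stepMean π n (c • φ) x = c * stepMean π n φ x :=
  integral_const_mul c _

theorem stepMean_nonneg (n : ℕ) {φ : X →ᵇ ℝ} (h : 0 ≤ φ) (x : X) : 0 ≤ stepMean π n φ x :=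
  integral_nonneg h

theorem stepMean_one [IsMarkovKernel π] (n : ℕ) (x : X) : stepMean π n 1 x = 1 := by
  have := isMarkovKernel_pow π n
  simp [stepMean]

variable [BorelSpace X]

theorem measurable_stepMean (n : ℕ) (φ : X →ᵇ ℝ) : Measurable (stepMean π n φ) :=
  (φ.continuous.measurable.stronglyMeasurable.integral_kernel (κ := π ^ n)).measurable

variable [IsMarkovKernel π]

theorem integrable_kernel_pow (n : ℕ) (φ : X →ᵇ ℝ) (x : X) :
    Integrable (fun y ↦ φ y) ((π ^ n) x) :=
  have := isMarkovKernel_pow π n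
  BoundedContinuousFunction.integrable _ φ

theorem abs_stepMean_le (n : ℕ) (φ : X →ᵇ ℝ) (x : X) : |stepMean π n φ x| ≤ ‖φ‖ := by
  have := isMarkovKernel_pow π n
  exact φ.norm_integral_le_norm _

theorem stepMean_mono (n : ℕ) {φ ψ : X →ᵇ ℝ} (h : φ ≤ ψ) (x : X) :
    stepMean π n φ x ≤ stepMean π n ψ x :=
  integral_mono (integrable_kernel_pow π n φ x) (integrable_kernel_pow π n ψ x) h

theorem stepMean_add (n : ℕ) (φ ψ : X →ᵇ ℝ) (x : X) :
    stepMean π n (φ + ψ) x = stepMean π n φ x + stepMean π n ψ x :=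
  integral_add (integrable_kernel_pow π n φ x) (integrable_kernel_pow π n ψ x)

theorem stepMean_sub (n : ℕ) (φ ψ : X →ᵇ ℝ) (x : X) :
    stepMean π n (φ - ψ) x = stepMean π n φ x - stepMean π n ψ x :=
  integral_sub (integrable_kernel_pow π n φ x) (integrable_kernel_pow π n ψ x)

theorem integrable_stepMean (μ : Measure X) [IsFiniteMeasure μ] (n : ℕ) (φ : X →ᵇ ℝ) :
    Integrable (stepMean π n φ) μ :=
  .of_bound (measurable_stepMean π n φ).aestronglyMeasurable ‖φ‖
    (ae_of_all _ fun x ↦ abs_stepMean_le π n φ x)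

/-- The Chapman–Kolmogorov equation for expectations. -/
theorem stepMean_add_time (m n : ℕ) (φ : X →ᵇ ℝ) (x : X) :
    stepMean π (n + m) φ x = ∫ y, stepMean π n φ y ∂((π ^ m) x) := by
  have h := integrable_kernel_pow π (n + m) φ x
  rw [stepMean]
  rw [Kernel.pow_add] at h ⊢
  exact Kernel.integral_comp h

theorem integral_stepLaw (n : ℕ) (φ : X →ᵇ ℝ) (μ : ProbabilityMeasure X) :
    ∫ y, φ y ∂(stepLaw π n μ : Measure X) = ∫ x, stepMean π n φ x ∂(μ : Measure X) :=
  integral_measure_bind (κ := π ^ n)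
    (BoundedContinuousFunction.integrable (stepLaw π n μ : Measure X) φ)

end StepMean

/-! ### Asymptotic merging by independent coupling. -/

section Merging

theorem lintegral_le_of_le_on {Ω : Type*} [MeasurableSpace Ω] {p : Measure Ω}
    [IsProbabilityMeasure p] {W : Ω → ℝ≥0∞} {S : Set Ω} (hS : MeasurableSet S) {b ε g : ℝ}
    (hε : 0 ≤ ε) (hεg : ε ≤ g) (hb : ENNReal.ofReal b ≤ p S) (hW : ∀ ω, W ω ≤ ENNReal.ofReal g)
    (hWS : ∀ ω ∈ S, W ω ≤ ENNReal.ofReal ε) :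
    ∫⁻ ω, W ω ∂p ≤ ENNReal.ofReal (g - b * (g - ε)) := by
  have h1 : ∫⁻ ω in S, W ω ∂p ≤ ENNReal.ofReal ε * p S := by
    refine (setLIntegral_mono' hS hWS).trans_eq ?_
    simp
  have h2 : ∫⁻ ω in Sᶜ, W ω ∂p ≤ ENNReal.ofReal g * p Sᶜ := by
    refine (lintegral_mono hW).trans_eq ?_
    simp
  have hbS : b ≤ p.real S := (ENNReal.ofReal_le_iff_le_toReal (measure_ne_top _ _)).1 hb
  rw [← lintegral_add_compl W hS]
  refine (add_le_add h1 h2).trans ?_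
  rw [← ofReal_measureReal, ← ofReal_measureReal, ← ENNReal.ofReal_mul hε,
    ← ENNReal.ofReal_mul (hε.trans hεg), ← ENNReal.ofReal_add (by positivity)
    (mul_nonneg (hε.trans hεg) measureReal_nonneg), probReal_compl_eq_one_sub hS]
  refine ENNReal.ofReal_le_ofReal ?_
  nlinarith [mul_le_mul_of_nonneg_right hbS (sub_nonneg.2 hεg)]

/-- Any `β` strictly between `0` and `α` serves: it is finite, and the bound holds eventually. The
constant is uniform in `x`; the time from which it holds is not. -/
theorem exists_eventually_le_ball {X : Type*} [MetricSpace X] [MeasurableSpace X]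
    (π : Kernel X X) {z : X}
    (hlower : ∀ ε : ℝ, 0 < ε → ∃ α : ℝ≥0∞, 0 < α ∧
      ∀ x : X, α ≤ liminf (fun n : ℕ ↦ (π ^ n) x (Metric.ball z ε)) atTop) {ε : ℝ} (hε : 0 < ε) :
    ∃ b : ℝ, 0 < b ∧ ∀ x, ∀ᶠ n in atTop, ENNReal.ofReal b ≤ (π ^ n) x (Metric.ball z ε) := by
  obtain ⟨α, hα, h⟩ := hlower ε hε
  obtain ⟨β, hβ, hβα⟩ := exists_between hα
  refine ⟨β.toReal, ENNReal.toReal_pos hβ.ne' hβα.ne_top, fun x ↦ ?_⟩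
  rw [ENNReal.ofReal_toReal hβα.ne_top]
  filter_upwards [eventually_lt_of_lt_liminf (hβα.trans_le (h x))] with n hn using hn.le

variable {X : Type*} [MetricSpace X] [MeasurableSpace X] [BorelSpace X]
  (π : Kernel X X) [IsMarkovKernel π]

/-- The asymptotic separation of the expectations of `φ` started from two points. -/
noncomputable def asympSep (φ : X →ᵇ ℝ) (x y : X) : ℝ≥0∞ :=
  limsup (fun n ↦ edist (stepMean π n φ x) (stepMean π n φ y)) atTop

theorem edist_stepMean_le (φ : X →ᵇ ℝ) (n : ℕ) (x y : X) :
    edist (stepMean π n φ x) (stepMean π n φ y) ≤ ENNReal.ofReal (2 * ‖φ‖) := by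
  rw [edist_dist]
  refine ENNReal.ofReal_le_ofReal ?_
  rw [Real.dist_eq, two_mul]
  exact (abs_sub _ _).trans (add_le_add (abs_stepMean_le π n φ x) (abs_stepMean_le π n φ y))

/-- Restart two independent copies at time `N`; the limsup ignores the shift, and reverse Fatou with
the bound `2 * ‖φ‖` moves it inside the integral. -/
theorem asympSep_le_lintegral (φ : X →ᵇ ℝ) (N : ℕ) (x y : X) :
    asympSep π φ x y ≤ ∫⁻ p, asympSep π φ p.1 p.2 ∂(((π ^ N) x).prod ((π ^ N) y)) := by
  have := isMarkovKernel_pow π N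
  have h1 : asympSep π φ x y =
      limsup (fun n ↦ edist (stepMean π (n + N) φ x) (stepMean π (n + N) φ y)) atTop :=
    (limsup_nat_add (fun n ↦ edist (stepMean π n φ x) (stepMean π n φ y)) N).symm
  have h2 := limsup_lintegral_le (μ := ((π ^ N) x).prod ((π ^ N) y))
    (f := fun n p ↦ edist (stepMean π n φ p.1) (stepMean π n φ p.2))
    (fun _ ↦ ENNReal.ofReal (2 * ‖φ‖))
    (fun n ↦ ((measurable_stepMean π n φ).comp measurable_fst).edist
      ((measurable_stepMean π n φ).comp measurable_snd))
    (fun n ↦ ae_of_all _ fun p ↦ edist_stepMean_le π φ n p.1 p.2)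
    (by rw [lintegral_const]; exact ENNReal.mul_ne_top ENNReal.ofReal_ne_top (measure_ne_top _ _))
  rw [h1]
  refine le_trans (limsup_le_limsup (Eventually.of_forall fun n ↦ ?_)) h2
  have hx : stepMean π (n + N) φ x =
      ∫ p, stepMean π n φ p.1 ∂(((π ^ N) x).prod ((π ^ N) y)) := by
    rw [stepMean_add_time, integral_fun_fst]
    simp
  have hy : stepMean π (n + N) φ y =
      ∫ p, stepMean π n φ p.2 ∂(((π ^ N) x).prod ((π ^ N) y)) := by
    rw [stepMean_add_time, integral_fun_snd]
    simp
  have hi := integrable_stepMean π ((π ^ N) x) n φ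
  have hi' := integrable_stepMean π ((π ^ N) y) n φ
  beta_reduce
  rw [hx, hy, edist_eq_enorm_sub, ← integral_sub (hi.comp_fst _) (hi'.comp_snd _)]
  simp_rw [edist_eq_enorm_sub]
  exact enorm_integral_le_lintegral_enorm _

theorem asympSep_eq_zero {z : X}
    (hlower : ∀ ε : ℝ, 0 < ε → ∃ α : ℝ≥0∞, 0 < α ∧
      ∀ x : X, α ≤ liminf (fun n : ℕ ↦ (π ^ n) x (Metric.ball z ε)) atTop)
    {φ : X →ᵇ ℝ} (hequi : EquicontinuousAt (fun n ↦ stepMean π n φ) z) (x y : X) :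
    asympSep π φ x y = 0 := by
  set G : ℝ≥0∞ := ⨆ (x) (y), asympSep π φ x y with hG
  -- Needed before passing to `G.toReal`, which would be `0` for `G = ∞`.
  have hGtop : G ≠ ∞ := ne_top_of_le_ne_top ENNReal.ofReal_ne_top
    (iSup₂_le fun x y ↦ limsup_le_of_le (h := Eventually.of_forall fun n ↦
      edist_stepMean_le π φ n x y))
  have hle : ∀ x y, asympSep π φ x y ≤ ENNReal.ofReal G.toReal := fun x y ↦ by
    rw [ENNReal.ofReal_toReal hGtop]
    exact le_iSup₂ (f := fun x y ↦ asympSep π φ x y) x y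
  suffices h : ∀ ε : ℝ, 0 < ε → G.toReal ≤ ε by
    have h0 : G.toReal ≤ 0 := le_of_forall_pos_le_add fun ε hε ↦ by simpa using h ε hε
    simpa [ENNReal.ofReal_eq_zero.2 h0] using hle x y
  intro ε hε
  by_contra! hlt
  obtain ⟨δ, hδ, hball⟩ := Metric.equicontinuousAt_iff.1 hequi (ε / 2) (half_pos hε)
  obtain ⟨b, hb, hev⟩ := exists_eventually_le_ball π hlower hδ
  have hS : ∀ p ∈ Metric.ball z δ ×ˢ Metric.ball z δ,
      asympSep π φ p.1 p.2 ≤ ENNReal.ofReal ε := by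
    rintro ⟨u, v⟩ ⟨hu, hv⟩
    refine limsup_le_of_le (h := Eventually.of_forall fun n ↦ ?_)
    rw [edist_dist]
    refine ENNReal.ofReal_le_ofReal ?_
    have h1 := hball u hu n
    have h2 := hball v hv n
    linarith [dist_triangle_left (stepMean π n φ u) (stepMean π n φ v) (stepMean π n φ z)]
  have hstep : ∀ x y, asympSep π φ x y ≤
      ENNReal.ofReal (G.toReal - b * b * (G.toReal - ε)) := by
    intro x y
    obtain ⟨N, hNx, hNy⟩ := ((hev x).and (hev y)).exists
    have := isMarkovKernel_pow π N
    refine (asympSep_le_lintegral π φ N x y).trans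
      (lintegral_le_of_le_on (measurableSet_ball.prod measurableSet_ball) hε.le hlt.le ?_
        (fun p ↦ hle p.1 p.2) hS)
    rw [Measure.prod_prod, ENNReal.ofReal_mul hb.le]
    exact mul_le_mul' hNx hNy
  have hGle : G ≤ ENNReal.ofReal (G.toReal - b * b * (G.toReal - ε)) :=
    iSup₂_le hstep
  have hpos : 0 < b * b * (G.toReal - ε) := mul_pos (mul_pos hb hb) (sub_pos.2 hlt)
  -- `ENNReal.ofReal` truncates at zero; a negative bound would force `G = 0`, against `ε < G`.
  rcases le_or_gt 0 (G.toReal - b * b * (G.toReal - ε)) with h0 | h0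
  · have := ENNReal.toReal_mono ENNReal.ofReal_ne_top hGle
    rw [ENNReal.toReal_ofReal h0] at this
    linarith
  · rw [ENNReal.ofReal_eq_zero.2 h0.le, nonpos_iff_eq_zero] at hGle
    rw [hGle] at hlt
    simp only [ENNReal.toReal_zero] at hlt
    linarith

theorem tendsto_stepMean_sub {z : X}
    (hlower : ∀ ε : ℝ, 0 < ε → ∃ α : ℝ≥0∞, 0 < α ∧
      ∀ x : X, α ≤ liminf (fun n : ℕ ↦ (π ^ n) x (Metric.ball z ε)) atTop)
    {φ : X →ᵇ ℝ} (hequi : EquicontinuousAt (fun n ↦ stepMean π n φ) z) (x y : X) :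
    Tendsto (fun n ↦ stepMean π n φ x - stepMean π n φ y) atTop (𝓝 0) := by
  have h := asympSep_eq_zero π hlower hequi x y
  have h1 : Tendsto (fun n ↦ edist (stepMean π n φ x) (stepMean π n φ y)) atTop (𝓝 0) :=
    tendsto_of_le_liminf_of_limsup_le zero_le h.le
  rw [tendsto_zero_iff_abs_tendsto_zero]
  have h2 := (ENNReal.tendsto_toReal ENNReal.zero_ne_top).comp h1
  simpa [Function.comp_def, edist_dist, Real.dist_eq] using h2

/-- The expectations of `φ` forget the initial law. -/
theorem tendsto_integral_stepMean_sub {z : X}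
    (hlower : ∀ ε : ℝ, 0 < ε → ∃ α : ℝ≥0∞, 0 < α ∧
      ∀ x : X, α ≤ liminf (fun n : ℕ ↦ (π ^ n) x (Metric.ball z ε)) atTop)
    {φ : X →ᵇ ℝ} (hequi : EquicontinuousAt (fun n ↦ stepMean π n φ) z)
    (μ : Measure X) [IsProbabilityMeasure μ] :
    Tendsto (fun n ↦ ∫ x, stepMean π n φ x ∂μ - stepMean π n φ z) atTop (𝓝 0) := by
  have h : ∀ n, ∫ x, stepMean π n φ x ∂μ - stepMean π n φ z =
      ∫ x, (stepMean π n φ x - stepMean π n φ z) ∂μ := fun n ↦ by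
    rw [integral_sub (integrable_stepMean π μ n φ) (integrable_const _)]
    simp
  simp_rw [h]
  rw [← integral_zero X ℝ (μ := μ)]
  refine tendsto_integral_of_dominated_convergence (fun _ ↦ 2 * ‖φ‖)
    (fun n ↦ ((measurable_stepMean π n φ).sub_const _).aestronglyMeasurable)
    (integrable_const _) (fun n ↦ ae_of_all _ fun x ↦ ?_)
    (ae_of_all _ fun x ↦ tendsto_stepMean_sub π hlower hequi x z)
  rw [Real.norm_eq_abs, two_mul]
  exact (abs_sub _ _).trans (add_le_add (abs_stepMean_le π n φ x) (abs_stepMean_le π n φ z))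

end Merging

/-! ### `σ`-smoothness of cluster functionals by a gliding hump. -/

section GlidingHump

theorem nonneg_of_antitone_of_tendsto {X : Type*} [TopologicalSpace X] {T : ℕ → X →ᵇ ℝ}
    (hT : Antitone T) (hT0 : ∀ x, Tendsto (fun k ↦ T k x) atTop (𝓝 0)) (k : ℕ) : 0 ≤ T k :=
  fun x ↦ Antitone.le_of_tendsto (f := fun k ↦ T k x) (fun _ _ h ↦ hT h x) (hT0 x) k

variable {X : Type*} [MetricSpace X] [MeasurableSpace X] [BorelSpace X]
  (π : Kernel X X) [IsMarkovKernel π]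

theorem tendsto_stepMean_of_antitone {T : ℕ → X →ᵇ ℝ} (hT : Antitone T) (hT1 : T 0 ≤ 1)
    (hT0 : ∀ x, Tendsto (fun k ↦ T k x) atTop (𝓝 0)) (n : ℕ) (y : X) :
    Tendsto (fun k ↦ stepMean π n (T k) y) atTop (𝓝 0) := by
  have := isMarkovKernel_pow π n
  have hnn := nonneg_of_antitone_of_tendsto hT hT0
  rw [← integral_zero X ℝ (μ := (π ^ n) y)]
  refine tendsto_integral_of_dominated_convergence (fun _ ↦ 1)
    (fun k ↦ (integrable_kernel_pow π n (T k) y).aestronglyMeasurable)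
    (integrable_const _) (fun k ↦ ae_of_all _ fun x ↦ ?_) (ae_of_all _ hT0)
  rw [Real.norm_of_nonneg (show 0 ≤ T k x from hnn k x)]
  exact (hT k.zero_le x).trans (hT1 x)

theorem mul_le_stepMean {z : X} {φ : X →ᵇ ℝ} (hφ : 0 ≤ φ) {S : Set X} (hS : MeasurableSet S)
    {b c : ℝ} (hc : 0 ≤ c) {m n : ℕ} (hb : ENNReal.ofReal b ≤ (π ^ m) z S)
    (hcS : ∀ y ∈ S, c ≤ stepMean π n φ y) : b * c ≤ stepMean π (n + m) φ z := by
  have := isMarkovKernel_pow π m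
  have hb' : b ≤ ((π ^ m) z).real S :=
    (ENNReal.ofReal_le_iff_le_toReal (measure_ne_top _ _)).1 hb
  rw [stepMean_add_time]
  refine (mul_le_mul_of_nonneg_right hb' hc).trans ?_
  rw [← smul_eq_mul, ← integral_indicator_const c hS]
  refine integral_mono ((integrable_const c).indicator hS)
    (integrable_stepMean π _ n φ) fun x ↦ ?_
  by_cases hx : x ∈ S
  · rw [Set.indicator_of_mem hx]
    exact hcS x hx
  · rw [Set.indicator_of_notMem hx]
    exact stepMean_nonneg π n hφ x

/-- Increments of a decreasing sequence of functions cannot all receive a fixed amount of mass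
from every point of a neighbourhood of `z`: at a late time too much mass would accumulate. -/
theorem exists_stepMean_increment_lt {z : X}
    (hlower : ∀ ε : ℝ, 0 < ε → ∃ α : ℝ≥0∞, 0 < α ∧
      ∀ x : X, α ≤ liminf (fun n : ℕ ↦ (π ^ n) x (Metric.ball z ε)) atTop)
    {T : ℕ → X →ᵇ ℝ} (hT : Antitone T) (hT1 : T 0 ≤ 1) (hTnn : ∀ k, 0 ≤ T k) (n : ℕ → ℕ)
    {c δ : ℝ} (hc : 0 < c) (hδ : 0 < δ) (i₀ : ℕ) :
    ∃ i ≥ i₀, ∃ y ∈ Metric.ball z δ, stepMean π (n i) (T i - T (i + 1)) y < c := by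
  by_contra! hcon
  obtain ⟨b, hb, hev⟩ := exists_eventually_le_ball π hlower hδ
  -- `M` increments, each of expectation at least `b * c` at a common time, telescope to a total of
  -- at most `1`.
  obtain ⟨M, hM⟩ := exists_nat_gt (1 / (b * c))
  rw [div_lt_iff₀ (mul_pos hb hc)] at hM
  -- One time `N` serves all `M` increments: the chain is in the ball at time `N - n (i₀ + i)` and
  -- then runs `n (i₀ + i)` more steps. The first conjunct keeps the subtraction from truncating.
  have hevM : ∀ᶠ N in atTop, ∀ i ∈ Finset.range M, n (i₀ + i) ≤ N ∧
      ENNReal.ofReal b ≤ (π ^ (N - n (i₀ + i))) z (Metric.ball z δ) := by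
    rw [eventually_all_finset]
    exact fun i _ ↦ (eventually_ge_atTop _).and ((tendsto_sub_atTop_nat _).eventually (hev z))
  obtain ⟨N, hN⟩ := hevM.exists
  have hsum : ∑ i ∈ Finset.range M, stepMean π N (T (i₀ + i) - T (i₀ + i + 1)) z =
      stepMean π N (T i₀) z - stepMean π N (T (i₀ + M)) z := by
    simp_rw [stepMean_sub]
    exact Finset.sum_range_sub' (fun i ↦ stepMean π N (T (i₀ + i)) z) M
  have hterm : ∀ i ∈ Finset.range M,
      b * c ≤ stepMean π N (T (i₀ + i) - T (i₀ + i + 1)) z := fun i hi ↦ by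
    have h := mul_le_stepMean π (sub_nonneg.2 (hT (i₀ + i).le_succ)) measurableSet_ball hc.le
      (hN i hi).2 (hcon (i₀ + i) (Nat.le_add_right _ _))
    rwa [Nat.add_sub_cancel' (hN i hi).1] at h
  have h1 := Finset.card_nsmul_le_sum _ _ _ hterm
  rw [hsum, Finset.card_range, nsmul_eq_mul] at h1
  have h2 := stepMean_nonneg π N (hTnn (i₀ + M)) z
  have h3 := stepMean_mono π N ((hT i₀.zero_le).trans hT1) z
  rw [stepMean_one] at h3
  linarith

/-- If `g` increases, `g + R` decreases and `R` tends to zero pointwise, then `g` has a bounded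
continuous limit. -/
theorem exists_limit_of_sandwich {X : Type*} [TopologicalSpace X] {g R : ℕ → X →ᵇ ℝ}
    (hg : Monotone g) (hgR : Antitone (g + R)) (hR0 : ∀ x, Tendsto (fun l ↦ R l x) atTop (𝓝 0))
    (hR : ∀ l, 0 ≤ R l) : ∃ F : X →ᵇ ℝ, ∀ l, g l ≤ F ∧ F ≤ g l + R l := by
  have hcross : ∀ l m x, g m x ≤ g l x + R l x := fun l m x ↦
    calc g m x ≤ g (max l m) x := hg (le_max_right l m) x
      _ ≤ g (max l m) x + R (max l m) x := le_add_of_nonneg_right (hR _ x)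
      _ ≤ g l x + R l x := hgR (le_max_left l m) x
  let F : X → ℝ := fun x ↦ ⨆ l, g l x
  have hbdd : ∀ x, BddAbove (Set.range fun l ↦ g l x) := fun x ↦
    ⟨g 0 x + R 0 x, by rintro _ ⟨m, rfl⟩; exact hcross 0 m x⟩
  have hle : ∀ l x, g l x ≤ F x := fun l x ↦ le_ciSup (hbdd x) l
  have hge : ∀ l x, F x ≤ g l x + R l x := fun l x ↦ ciSup_le fun m ↦ hcross l m x
  have hcont : Continuous F := by
    -- The error of `g l` is at most `R l`, which is continuous and so stays below `ε` near any
    -- point where it is below `ε`. The approximation is thus locally uniform without compactness.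
    refine continuous_of_locally_uniform_approx_of_continuousAt fun x u hu ↦ ?_
    obtain ⟨ε, hε, hεu⟩ := Metric.mem_uniformity_dist.1 hu
    obtain ⟨l, hl⟩ := ((hR0 x).eventually_lt_const hε).exists
    refine ⟨{y | R l y < ε}, (R l).continuous.continuousAt.eventually_lt_const hl, g l,
      (g l).continuous.continuousAt, fun y hy ↦ hεu ?_⟩
    have hy' : R l y < ε := hy
    rw [Real.dist_eq, abs_of_nonneg (sub_nonneg.2 (hle l y))]
    linarith [hge l y]
  refine ⟨BoundedContinuousFunction.ofNormedAddCommGroup F hcont (‖g 0‖ + ‖R 0‖) fun x ↦ ?_,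
    fun l ↦ ⟨hle l, hge l⟩⟩
  have h1 := abs_le.1 ((g 0).norm_coe_le_norm x)
  have h2 := abs_le.1 ((R 0).norm_coe_le_norm x)
  rw [Real.norm_eq_abs, abs_le]
  constructor <;> linarith [hle 0 x, hge 0 x, norm_nonneg (R 0)]

/-- Pick sparse increments that are large seen from `z` but small seen from points `y` approaching
`z`. Their sum `F` is bounded and continuous, and its expectations at `z` and at these `y` stay
apart by more than `c / 2`, which contradicts equicontinuity for `F`. -/
theorem false_of_increments {z : X}
    (hlower : ∀ ε : ℝ, 0 < ε → ∃ α : ℝ≥0∞, 0 < α ∧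
      ∀ x : X, α ≤ liminf (fun n : ℕ ↦ (π ^ n) x (Metric.ball z ε)) atTop)
    (hequi : ∀ φ : X →ᵇ ℝ, EquicontinuousAt (fun n ↦ stepMean π n φ) z)
    {T : ℕ → X →ᵇ ℝ} (hT : Antitone T) (hT1 : T 0 ≤ 1)
    (hT0 : ∀ x, Tendsto (fun k ↦ T k x) atTop (𝓝 0)) (n : ℕ → ℕ) {c : ℝ} (hc : 0 < c)
    (hinc : ∀ i, 2 * c ≤ stepMean π (n i) (T i - T (i + 1)) z) : False := by
  have hTnn := nonneg_of_antitone_of_tendsto hT hT0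
  have step : ∀ (s : ℕ × (X →ᵇ ℝ)) (l : ℕ), ∃ i j : ℕ, ∃ y : X, s.1 ≤ i ∧ i < j ∧
      dist y z < 1 / ((l : ℝ) + 1) ∧ stepMean π (n i) (T i - T (i + 1)) y < c ∧
      |stepMean π (n i) s.2 z - stepMean π (n i) s.2 y| < c / 4 ∧
      stepMean π (n i) (T j) y < c / 4 := by
    rintro ⟨j, g⟩ l
    obtain ⟨δ, hδ, hball⟩ := Metric.equicontinuousAt_iff.1 (hequi g) (c / 4) (by positivity)
    have hl : 0 < 1 / ((l : ℝ) + 1) := by positivity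
    obtain ⟨i, hi, y, hy, hyc⟩ :=
      exists_stepMean_increment_lt π hlower hT hT1 hTnn n hc (lt_min hδ hl) j
    obtain ⟨k, hk, hik⟩ := (((tendsto_stepMean_of_antitone π hT hT1 hT0 (n i) y).eventually_lt_const
      (show 0 < c / 4 by positivity)).and (eventually_gt_atTop i)).exists
    rw [Metric.mem_ball, lt_min_iff] at hy
    exact ⟨i, k, y, hi, hik, hy.2, hyc, hball y hy.1 (n i), hk⟩
  choose i j y hi hij hdist hyc hyg hyT using step
  -- The state holds the first index still available and the sum of the increments chosen so far.
  let s : ℕ → ℕ × (X →ᵇ ℝ) := fun l ↦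
    Nat.rec (0, 0) (fun l s ↦ (j s l, s.2 + (T (i s l) - T (i s l + 1)))) l
  have hs1 : ∀ l, (s (l + 1)).1 = j (s l) l := fun l ↦ rfl
  have hs2 : ∀ l, (s (l + 1)).2 = (s l).2 + (T (i (s l) l) - T (i (s l) l + 1)) := fun l ↦ rfl
  have hjmono : StrictMono fun l ↦ (s l).1 := strictMono_nat_of_lt_succ fun l ↦ by
    rw [hs1]
    exact (hi (s l) l).trans_lt (hij (s l) l)
  obtain ⟨F, hF⟩ := exists_limit_of_sandwich (g := fun l ↦ (s l).2) (R := fun l ↦ T (s l).1)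
    (monotone_nat_of_le_succ fun l ↦ by
      rw [hs2]
      exact le_add_of_nonneg_right (sub_nonneg.2 (hT (Nat.le_succ _))))
    (antitone_nat_of_succ_le fun l x ↦ by
      have h1 := hT (hi (s l) l) x
      have h2 := hT (Nat.succ_le_of_lt (hij (s l) l)) x
      change (s (l + 1)).2 x + T (s (l + 1)).1 x ≤ (s l).2 x + T (s l).1 x
      rw [hs1, hs2]
      change (s l).2 x + (T (i (s l) l) x - T (i (s l) l + 1) x) + T (j (s l) l) x ≤ _
      change T (i (s l) l) x ≤ T (s l).1 x at h1
      change T (j (s l) l) x ≤ T (i (s l) l + 1) x at h2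
      linarith)
    (fun x ↦ (hT0 x).comp hjmono.tendsto_atTop) (fun l ↦ hTnn _)
  obtain ⟨δ, hδ, hball⟩ := Metric.equicontinuousAt_iff.1 (hequi F) (c / 2) (by positivity)
  obtain ⟨l, hl⟩ := exists_nat_one_div_lt hδ
  have h := hball (y (s l) l) ((hdist (s l) l).trans hl) (n (i (s l) l))
  have h1 := stepMean_mono π (n (i (s l) l)) (hF (l + 1)).1 z
  have h2 := stepMean_mono π (n (i (s l) l)) (hF (l + 1)).2 (y (s l) l)
  have h3 := hinc (i (s l) l)
  have h4 := hyc (s l) l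
  have h5 := abs_lt.1 (hyg (s l) l)
  have h6 := hyT (s l) l
  simp only [hs1, hs2, stepMean_add] at h1 h2
  rw [Real.dist_eq, abs_lt] at h
  -- At time `n (i (s l) l)` the new increment contributes a gap of more than `2c - c`; the earlier
  -- sum and the tail bounded by `T (j (s l) l)` take back less than `c / 4` each.
  linarith [h.2, h5.1]

/-- A cluster functional of the laws of the chain started from `z` is `σ`-smooth. -/
theorem isSigmaSmooth_of_tendsto {z : X}
    (hlower : ∀ ε : ℝ, 0 < ε → ∃ α : ℝ≥0∞, 0 < α ∧
      ∀ x : X, α ≤ liminf (fun n : ℕ ↦ (π ^ n) x (Metric.ball z ε)) atTop)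
    (hequi : ∀ φ : X →ᵇ ℝ, EquicontinuousAt (fun n ↦ stepMean π n φ) z)
    {U : Filter ℕ} [U.NeBot] {L : (X →ᵇ ℝ) →ₗ[ℝ] ℝ}
    (hL : ∀ φ, Tendsto (fun n ↦ stepMean π n φ z) U (𝓝 (L φ))) : IsSigmaSmooth L := by
  intro φ hφ hφ1 hφ0
  have hnn := nonneg_of_antitone_of_tendsto hφ hφ0
  have hLnn : ∀ k, 0 ≤ L (φ k) := fun k ↦
    ge_of_tendsto' (hL (φ k)) fun n ↦ stepMean_nonneg π n (hnn k) z
  have hLanti : Antitone fun k ↦ L (φ k) := fun k l hkl ↦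
    le_of_tendsto_of_tendsto' (hL _) (hL _) fun n ↦ stepMean_mono π n (hφ hkl) z
  by_contra hnot
  -- From `3c`, a late `φ k'` costs less than `c` at the chosen time, which leaves the increment
  -- `2c`.
  obtain ⟨c, hc, hcL⟩ : ∃ c : ℝ, 0 < c ∧ ∀ k, 3 * c < L (φ k) := by
    by_contra! hcon
    refine hnot (Metric.tendsto_atTop.2 fun ε hε ↦ ?_)
    obtain ⟨k, hk⟩ := hcon (ε / 4) (by positivity)
    refine ⟨k, fun m hm ↦ ?_⟩
    rw [Real.dist_0_eq_abs, abs_of_nonneg (hLnn m)]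
    linarith [hLanti hm]
  have step : ∀ k, ∃ n k', k < k' ∧ 2 * c ≤ stepMean π n (φ k - φ k') z := by
    intro k
    obtain ⟨n, hn⟩ := ((hL (φ k)).eventually_const_lt (hcL k)).exists
    obtain ⟨k', hk', hkk'⟩ := (((tendsto_stepMean_of_antitone π hφ hφ1 hφ0 n z).eventually_lt_const
      hc).and (eventually_gt_atTop k)).exists
    refine ⟨n, k', hkk', ?_⟩
    rw [stepMean_sub]
    linarith
  choose n next hnext hstep using step
  let κ : ℕ → ℕ := fun i ↦ next^[i] 0
  have hκ : ∀ i, κ (i + 1) = next (κ i) := fun i ↦ Function.iterate_succ_apply' next i 0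
  have hκmono : StrictMono κ := strictMono_nat_of_lt_succ fun i ↦ by
    rw [hκ]
    exact hnext _
  refine false_of_increments π hlower hequi (T := fun i ↦ φ (κ i))
    (hφ.comp_monotone hκmono.monotone) hφ1 (fun x ↦ (hφ0 x).comp hκmono.tendsto_atTop)
    (fun i ↦ n (κ i)) hc fun i ↦ ?_
  rw [hκ]
  exact hstep (κ i)

end GlidingHump

/-! ### Existence, uniqueness and attraction of the invariant law. -/

section InvariantMeasure

theorem stepLaw_eq_of_invariant {X : Type*} [MeasurableSpace X] (π : Kernel X X) [IsMarkovKernel π]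
    {μ : ProbabilityMeasure X}
    (hμ : Kernel.Invariant π (μ : Measure X)) (n : ℕ) : stepLaw π n μ = μ := by
  refine Subtype.ext ?_
  change (μ : Measure X).bind (π ^ n : Kernel X X) = μ
  induction n with
  | zero =>
    rw [pow_zero]
    exact Measure.id_comp
  | succ n ih =>
    rw [pow_succ]
    exact Kernel.Invariant.comp ih hμ

variable {X : Type*} [MetricSpace X] [MeasurableSpace X] [BorelSpace X]
  (π : Kernel X X) [IsMarkovKernel π]

/-- Along an ultrafilter, the laws of the chain converge to a linear functional on bounded
continuous functions. -/
theorem exists_limit_functional (U : Ultrafilter ℕ) (z : X) :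
    ∃ L : (X →ᵇ ℝ) →ₗ[ℝ] ℝ, ∀ φ, Tendsto (fun n ↦ stepMean π n φ z) U (𝓝 (L φ)) := by
  have h : ∀ φ : X →ᵇ ℝ, ∃ l, Tendsto (fun n ↦ stepMean π n φ z) U (𝓝 l) := fun φ ↦ by
    obtain ⟨l, -, hl⟩ := (isCompact_Icc (a := -‖φ‖) (b := ‖φ‖)).ultrafilter_le_nhds
      (U.map fun n ↦ stepMean π n φ z) (by
        rw [Ultrafilter.coe_map, le_principal_iff, mem_map]
        exact Eventually.of_forall fun n ↦ abs_le.1 (abs_stepMean_le π n φ z))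
    exact ⟨l, hl⟩
  choose L hL using h
  refine ⟨⟨⟨L, fun φ ψ ↦ tendsto_nhds_unique (hL (φ + ψ)) ?_⟩,
    fun c φ ↦ tendsto_nhds_unique (hL (c • φ)) ?_⟩, hL⟩
  · simp_rw [stepMean_add]
    exact (hL φ).add (hL ψ)
  · simp_rw [stepMean_smul]
    exact (hL φ).const_mul c

/-- The Feller property puts `Pφ` in the domain of `L`. Since `P^n (Pφ)(z)` is the `n`-step
expectation of `φ` from the initial law `π z`, merging gives `L (Pφ) = L φ`. -/
theorem exists_invariant {z : X} (hFeller : IsFellerKernel π)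
    (hlower : ∀ ε : ℝ, 0 < ε → ∃ α : ℝ≥0∞, 0 < α ∧
      ∀ x : X, α ≤ liminf (fun n : ℕ ↦ (π ^ n) x (Metric.ball z ε)) atTop)
    (hequi : ∀ φ : X →ᵇ ℝ, EquicontinuousAt (fun n ↦ stepMean π n φ) z) :
    ∃ μ : ProbabilityMeasure X, Kernel.Invariant π (μ : Measure X) := by
  obtain ⟨L, hL⟩ := exists_limit_functional π (hyperfilter ℕ) z
  obtain ⟨μ, hμfin, hμ⟩ := exists_measure_of_isSigmaSmooth
    (fun f hf ↦ ge_of_tendsto' (hL f) fun n ↦ stepMean_nonneg π n hf z)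
    (isSigmaSmooth_of_tendsto π hlower hequi hL)
  have hL1 : L 1 = 1 := tendsto_nhds_unique (hL 1) (by
    simp_rw [stepMean_one]
    exact tendsto_const_nhds)
  have hμ1 := hμ 1
  rw [hL1] at hμ1
  have hprob : IsProbabilityMeasure μ := by
    rw [isProbabilityMeasure_iff_real]
    simpa using hμ1
  refine ⟨⟨μ, hprob⟩, ?_⟩
  change μ.bind π = μ
  refine ext_of_forall_integral_eq_of_IsFiniteMeasure fun φ ↦ ?_
  let Pφ : X →ᵇ ℝ := BoundedContinuousFunction.ofNormedAddCommGroup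
    (fun x ↦ ∫ y, φ y ∂(π x)) (hFeller φ) ‖φ‖ fun x ↦ φ.norm_integral_le_norm _
  have hshift : ∀ n, stepMean π n Pφ z = ∫ x, stepMean π n φ x ∂(π z) := fun n ↦ by
    -- Chapman–Kolmogorov split both ways: the single step is taken first in `h1` and last in `h2`.
    have h1 := stepMean_add_time π n 1 φ z
    have h2 := stepMean_add_time π 1 n φ z
    rw [add_comm n 1, h1, pow_one] at h2
    rw [← h2]
    simp only [stepMean, pow_one]
    rfl
  have hLP : L Pφ = L φ := by
    refine tendsto_nhds_unique (hL Pφ) ?_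
    have h := (tendsto_integral_stepMean_sub π hlower (hequi φ) (π z)).mono_left
      Nat.hyperfilter_le_atTop
    have h' := h.add (hL φ)
    simp_rw [sub_add_cancel, zero_add, ← hshift] at h'
    exact h'
  calc ∫ x, φ x ∂(μ.bind π) = ∫ x, Pφ x ∂μ :=
        integral_measure_bind (BoundedContinuousFunction.integrable _ φ)
    _ = ∫ x, φ x ∂μ := by rw [hμ, hμ, hLP]

/-- All initial laws converge weakly to an invariant probability measure. -/
theorem tendsto_stepLaw {z : X}
    (hlower : ∀ ε : ℝ, 0 < ε → ∃ α : ℝ≥0∞, 0 < α ∧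
      ∀ x : X, α ≤ liminf (fun n : ℕ ↦ (π ^ n) x (Metric.ball z ε)) atTop)
    (hequi : ∀ φ : X →ᵇ ℝ, EquicontinuousAt (fun n ↦ stepMean π n φ) z)
    {μstar : ProbabilityMeasure X} (hinv : Kernel.Invariant π (μstar : Measure X))
    (μ : ProbabilityMeasure X) : Tendsto (fun n ↦ stepLaw π n μ) atTop (𝓝 μstar) := by
  rw [ProbabilityMeasure.tendsto_iff_forall_integral_tendsto]
  intro φ
  -- Both `μ` and `μstar` merge with the chain from `z`, and the law from `μstar` does not move.
  have h1 := tendsto_integral_stepMean_sub π hlower (hequi φ) (μ : Measure X)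
  have h2 := tendsto_integral_stepMean_sub π hlower (hequi φ) (μstar : Measure X)
  have h3 := (h1.sub h2).add_const (∫ x, φ x ∂(μstar : Measure X))
  rw [sub_zero, zero_add] at h3
  refine h3.congr fun n ↦ ?_
  rw [← integral_stepLaw, ← integral_stepLaw, stepLaw_eq_of_invariant π hinv]
  ring

end InvariantMeasure

theorem theorem4p3 {X : Type*} [MetricSpace X] [MeasurableSpace X] [BorelSpace X]
    (π : Kernel X X) [IsMarkovKernel π] (hFeller : IsFellerKernel π) (z : X)
    (hlower : ∀ ε : ℝ, 0 < ε → ∃ α : ℝ≥0∞, 0 < α ∧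
      ∀ x : X, α ≤ liminf (fun n : ℕ ↦ (π ^ n) x (Metric.ball z ε)) atTop)
    (hequi : ∀ φ : X →ᵇ ℝ,
      EquicontinuousAt (fun (n : ℕ) (x : X) ↦ ∫ y, φ y ∂((π ^ n) x)) z) :
    ∃ μstar : ProbabilityMeasure X,
      Kernel.Invariant π (μstar : Measure X) ∧
      (∀ ν : ProbabilityMeasure X, Kernel.Invariant π (ν : Measure X) → ν = μstar) ∧
      ∀ μ : ProbabilityMeasure X,
        Tendsto (fun n : ℕ ↦ stepLaw π n μ) atTop (𝓝 μstar) := by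
  obtain ⟨μstar, hinv⟩ := exists_invariant π hFeller hlower hequi
  refine ⟨μstar, hinv, fun ν hν ↦ ?_, tendsto_stepLaw π hlower hequi hinv⟩
  -- For invariant `ν` the sequence of laws is constant, so its limit `μstar` must be `ν`.
  have h := tendsto_stepLaw π hlower hequi hinv ν
  simp_rw [stepLaw_eq_of_invariant π hν] at h
  exact tendsto_nhds_unique tendsto_const_nhds h
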